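/- Let $A\in\mathbb{R}^{m\times n}$ have full row rank ($\operatorname{rank}A=m\le n$), let $b\in\mathbb{R}^m$, and let $K\subseteq\mathbb{R}^n$ be a nonempty closed convex cone (a set $K$ is a cone if $K=\lambda K$ for all $\lambda>0$). Consider a conic program $(\mathrm{P})$: minimize $c^Tx$ subject to $Ax=b$, $x\in K$. It is feasible if $K\cap\{x\mid Ax=b\}\neq\emptyset$ and infeasible otherwise. When infeasible, it is strongly infeasible if $d(K,\{x\mid Ax=b\})>0$ and weakly infeasible if $d(K,\{x\mid Ax=b\})=0$, where $d(C_1,C_2)=\inf\{\|x-y\|\mid x\in C_1,\ y\in C_2\}$ and $\|\cdot\|$ is the Euclidean norm. For $C\subseteq\mathbb{R}^n$ let $P_C(x)=\operatorname{argmin}_{y\in C}\|y-x\|^2$ be the projection onto $C$ (where it is uniquely defined) and $R_C=2P_C-I$ the reflection. Let $\mathcal{N}(A)$ be the null space of $A$, let $x_0=A^T(AA^T)^{-1}b$, and define $$T_2(z)=\tfrac12\bigl(I+R_{\mathcal{N}(A)}R_K\bigr)(z)+x_0 .$$ The infimal displacement vector of $T_2$ is $v=P_{\overline{\operatorname{ran}(I-T_2)}}(0)$,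 where $\operatorname{ran}(I-T_2)=\{x-T_2(x)\mid x\in\mathbb{R}^n\}$. Theorem (Certificate of strong infeasibility). The vector $v$ is well defined, that is, $\overline{\operatorname{ran}(I-T_2)}$ has exactly one element of minimal norm, and $v=P_{\overline{K-\{x\mid Ax=b\}}}(0)$. For the iteration $z^{k+1}=T_2(z^k)$ with any starting point $z^0\in\mathbb{R}^n$, $z^k-z^{k+1}\to v$. Moreover: 1. $(\mathrm{P})$ is strongly infeasible if and only if $v\neq 0$. 2. $(\mathrm{P})$ is weakly infeasible or feasible if and only if $v=0$. -/

import Mathlib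

open Filter Topology
open scoped Pointwise Matrix

namespace ConicDRS

/-- A set `K ⊆ ℝⁿ` is a cone if `K = t K` for every `t > 0`. -/
def IsCone {n : ℕ} (K : Set (EuclideanSpace ℝ (Fin n))) : Prop :=
  ∀ t : ℝ, 0 < t → K = t • K

/-- `p` is a nearest point of `C` to `x`, i.e. `p ∈ argmin_{y ∈ C} ‖y - x‖²`. -/
def IsNearestPoint {n : ℕ} (C : Set (EuclideanSpace ℝ (Fin n)))
    (x p : EuclideanSpace ℝ (Fin n)) : Prop :=
  p ∈ C ∧ ∀ y ∈ C, ‖p - x‖ ^ 2 ≤ ‖y - x‖ ^ 2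

open Classical in
/-- The projection `P_C(x) = argmin_{y ∈ C} ‖y - x‖²`. It is meaningful when the nearest point
exists and is unique, in particular for nonempty closed convex `C`
(see `isNearestPoint_iff_eq_proj`). -/
noncomputable def proj {n : ℕ} (C : Set (EuclideanSpace ℝ (Fin n)))
    (x : EuclideanSpace ℝ (Fin n)) : EuclideanSpace ℝ (Fin n) :=
  if h : ∃ p, IsNearestPoint C x p then h.choose else 0

/-- For a nonempty closed convex set the nearest point exists, is unique, and is `proj C x`. -/
theorem isNearestPoint_iff_eq_proj {n : ℕ} {C : Set (EuclideanSpace ℝ (Fin n))}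
    (hne : C.Nonempty) (hcl : IsClosed C) (hcv : Convex ℝ C)
    (x p : EuclideanSpace ℝ (Fin n)) : IsNearestPoint C x p ↔ p = proj C x := by
  have hex : ∃ p, IsNearestPoint C x p := by
    obtain ⟨q, hq, hqd⟩ := hcl.exists_infDist_eq_dist hne x
    refine ⟨q, hq, fun y hy => ?_⟩
    have h1 : Metric.infDist x C ≤ dist x y := Metric.infDist_le_dist_of_mem hy
    rw [hqd, dist_comm x q, dist_comm x y, dist_eq_norm, dist_eq_norm] at h1
    gcongr
  have huniq : ∀ p q, IsNearestPoint C x p → IsNearestPoint C x q → p = q := by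
    intro p q hp hq
    have hm : (1 / 2 : ℝ) • p + (1 / 2 : ℝ) • q ∈ C :=
      hcv hp.1 hq.1 (by norm_num) (by norm_num) (by norm_num)
    have h1 := hp.2 _ hm
    have h2 := hq.2 _ hp.1
    have h3 := hp.2 _ hq.1
    have hpar := parallelogram_law_with_norm ℝ (p - x) (q - x)
    have e1 : (1 / 2 : ℝ) • p + (1 / 2 : ℝ) • q - x
        = (1 / 2 : ℝ) • ((p - x) + (q - x)) := by module
    have e2 : (p - x) - (q - x) = p - q := by abel
    rw [e1, norm_smul, mul_pow, Real.norm_of_nonneg (by norm_num : (0 : ℝ) ≤ 1 / 2)] at h1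
    rw [e2] at hpar
    have h4 : ‖p - q‖ ^ 2 ≤ 0 := by nlinarith
    have h5 : ‖p - q‖ = 0 := by nlinarith [norm_nonneg (p - q)]
    exact sub_eq_zero.mp (norm_eq_zero.mp h5)
  have hs : IsNearestPoint C x (proj C x) := by
    rw [proj, dif_pos hex]
    exact hex.choose_spec
  exact ⟨fun h => huniq _ _ h hs, fun h => h ▸ hs⟩

/-- The reflection `R_C(x) = 2 P_C(x) - x`. -/
noncomputable def refl {n : ℕ} (C : Set (EuclideanSpace ℝ (Fin n)))
    (x : EuclideanSpace ℝ (Fin n)) : EuclideanSpace ℝ (Fin n) :=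
  (2 : ℝ) • proj C x - x

/-- The affine set `{x | A x = b}`. -/
def affineSet {m n : ℕ} (A : Matrix (Fin m) (Fin n) ℝ) (b : Fin m → ℝ) :
    Set (EuclideanSpace ℝ (Fin n)) :=
  {x | A *ᵥ x.ofLp = b}

/-- The null space `{x | A x = 0}`. -/
def nullSpace {m n : ℕ} (A : Matrix (Fin m) (Fin n) ℝ) : Set (EuclideanSpace ℝ (Fin n)) :=
  {x | A *ᵥ x.ofLp = 0}

/-- `x₀ = Aᵀ (A Aᵀ)⁻¹ b`. -/
noncomputable def x₀ {m n : ℕ} (A : Matrix (Fin m) (Fin n) ℝ) (b : Fin m → ℝ) :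
    EuclideanSpace ℝ (Fin n) :=
  WithLp.toLp 2 (Aᵀ *ᵥ ((A * Aᵀ)⁻¹ *ᵥ b))

/-- `T̃(z) = ½ (I + R_{N(A)} R_K)(z)`. -/
noncomputable def Ttilde {m n : ℕ} (A : Matrix (Fin m) (Fin n) ℝ)
    (K : Set (EuclideanSpace ℝ (Fin n))) (z : EuclideanSpace ℝ (Fin n)) :
    EuclideanSpace ℝ (Fin n) :=
  (1 / 2 : ℝ) • (z + refl (nullSpace A) (refl K z))

/-- `T₂(z) = T̃(z) + x₀`. -/
noncomputable def T₂ {m n : ℕ} (A : Matrix (Fin m) (Fin n) ℝ) (b : Fin m → ℝ)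
    (K : Set (EuclideanSpace ℝ (Fin n))) (z : EuclideanSpace ℝ (Fin n)) :
    EuclideanSpace ℝ (Fin n) :=
  Ttilde A K z + x₀ A b

/-- The range `ran (I - T) = {x - T x}`. -/
def ranDisplacement {n : ℕ} (T : EuclideanSpace ℝ (Fin n) → EuclideanSpace ℝ (Fin n)) :
    Set (EuclideanSpace ℝ (Fin n)) :=
  Set.range fun x => x - T x

/-- The infimal displacement vector: the projection of `0` onto the closure of `ran (I - T)`. -/
noncomputable def infimalDisplacement {n : ℕ}
    (T : EuclideanSpace ℝ (Fin n) → EuclideanSpace ℝ (Fin n)) : EuclideanSpace ℝ (Fin n) :=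
  proj (closure (ranDisplacement T)) 0

/-- `d(C₁, C₂) = inf {‖x - y‖ | x ∈ C₁, y ∈ C₂}`. -/
noncomputable def setDist {n : ℕ} (C₁ C₂ : Set (EuclideanSpace ℝ (Fin n))) : ℝ :=
  sInf {r : ℝ | ∃ x ∈ C₁, ∃ y ∈ C₂, r = ‖x - y‖}

/-- The conic program with constraints `A x = b`, `x ∈ K` is feasible. -/
def Feasible {m n : ℕ} (A : Matrix (Fin m) (Fin n) ℝ) (b : Fin m → ℝ)
    (K : Set (EuclideanSpace ℝ (Fin n))) : Prop :=
  (K ∩ affineSet A b).Nonempty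

/-- Infeasible, with `d(K, {x | A x = b}) > 0`. -/
def StronglyInfeasible {m n : ℕ} (A : Matrix (Fin m) (Fin n) ℝ) (b : Fin m → ℝ)
    (K : Set (EuclideanSpace ℝ (Fin n))) : Prop :=
  ¬ Feasible A b K ∧ 0 < setDist K (affineSet A b)

/-- Infeasible, with `d(K, {x | A x = b}) = 0`. -/
def WeaklyInfeasible {m n : ℕ} (A : Matrix (Fin m) (Fin n) ℝ) (b : Fin m → ℝ)
    (K : Set (EuclideanSpace ℝ (Fin n))) : Prop :=
  ¬ Feasible A b K ∧ setDist K (affineSet A b) = 0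

end ConicDRS

/-!
Write `D = K - {x | A x = b}`, `u` for the point of least norm in `closure D`, `Q` for the
orthogonal projection onto the null space of `A` and `p = P_K z`. Since `Q` is linear,
`z - T₂ z = p - (x₀ + Q (2 p - z))` (`sub_T₂`), which is an element of `D` because
`p ∈ K` and `x₀` solves `A x = b`. So `closure (ran (I - T₂)) ⊆ closure D`, and everything
reduces to `u ∈ closure (ran (I - T₂))`: then `u` is the unique element of least norm of both sets,
although the smaller one is not known to be convex.

To approach `u`, minimise `‖(I - Q) (p - x₀)‖² + ε ‖p‖²` over `p ∈ K`. The first-order condition at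
the minimiser says that `p = P_K z` for `z = p - (I - Q) (p - x₀) - ε p`, and, as `Q x₀ = 0`, the displacement
at this `z` is `(I - Q) (p - x₀) - ε Q p`, whose squared norm is at most the minimal value of the
objective when `ε ≤ 1` (`exists_displacement_norm_sq_le`). As `ε → 0` these norms come
arbitrarily close to `‖u‖`, and a vector of `closure D` whose norm is close to `‖u‖` is close to `u`.

For the iteration, `T₂` is firmly nonexpansive. Displacements along an orbit have nonincreasing
norm, so an orbit `w` started where the displacement is close to `u` keeps its displacements
close to `u`. For any other orbit `z` the squared distances
`‖z k - w k‖²` drop by at least `‖(z k - z (k + 1)) - (w k - w (k + 1))‖²` at each step, so the two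
sequences of displacements have the same limit behaviour
(`tendsto_displacement_of_firmlyNonexpansive`).

The (in)feasibility criteria hold because `d(K, {x | A x = b}) = ‖u‖`.
-/

open scoped RealInnerProductSpace

namespace ConicDRS

/-! ### Least-norm points and firmly nonexpansive maps in real inner product spaces -/

section InnerProduct

variable {E : Type*} [NormedAddCommGroup E] [InnerProductSpace ℝ E]

theorem nonneg_of_forall_linear_add_quadratic {a c : ℝ}
    (h : ∀ s : ℝ, 0 < s → s ≤ 1 → 0 ≤ 2 * s * a + s ^ 2 * c) : 0 ≤ a := by
  have hlim : Tendsto (fun s : ℝ => 2 * a + s * c) (𝓝[>] 0) (𝓝 (2 * a)) := by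
    have : Continuous fun s : ℝ => 2 * a + s * c := by fun_prop
    simpa using (this.tendsto 0).mono_left nhdsWithin_le_nhds
  have hev : ∀ᶠ s : ℝ in 𝓝[>] 0, 0 ≤ 2 * a + s * c := by
    filter_upwards [Ioc_mem_nhdsGT (zero_lt_one' ℝ)] with s hs
    refine (mul_nonneg_iff_of_pos_left hs.1).1 ?_
    linarith [h s hs.1 hs.2]
  linarith [ge_of_tendsto hlim hev]

theorem norm_sub_sq_le_of_norm_sq_le_inner {u w : E} (h : ‖u‖ ^ 2 ≤ ⟪u, w⟫) :
    ‖w - u‖ ^ 2 ≤ ‖w‖ ^ 2 - ‖u‖ ^ 2 := by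
  rw [norm_sub_sq_real, real_inner_comm]
  linarith

/-- The iterates of a firmly nonexpansive map `T`, with firm nonexpansiveness stated for the
displacement `I - T`, have displacements converging to `u`, provided that `u` is a limit of
displacements and satisfies the variational inequality of a point of least norm. -/
theorem tendsto_displacement_of_firmlyNonexpansive {T : E → E} {u : E}
    (hT : ∀ x y, ‖(x - T x) - (y - T y)‖ ^ 2 ≤ ⟪(x - T x) - (y - T y), x - y⟫)
    (hu : u ∈ closure (Set.range fun x => x - T x))
    (hmin : ∀ x, ‖u‖ ^ 2 ≤ ⟪u, x - T x⟫)
    {z : ℕ → E} (hz : ∀ k, z (k + 1) = T (z k)) :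
    Tendsto (fun k => z k - z (k + 1)) atTop (𝓝 u) := by
  have hfirm (x y : E) :
      ‖(x - T x) - (y - T y)‖ ^ 2 ≤ ‖x - y‖ ^ 2 - ‖T x - T y‖ ^ 2 := by
    have e : T x - T y = (x - y) - ((x - T x) - (y - T y)) := by abel
    rw [e, norm_sub_sq_real (x - y), real_inner_comm _ (x - y)]
    linarith [hT x y]
  have hnonexp (x y : E) : ‖T x - T y‖ ≤ ‖x - y‖ := by
    refine le_of_sq_le_sq ?_ (norm_nonneg _)
    linarith [hfirm x y, sq_nonneg ‖(x - T x) - (y - T y)‖]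
  simp only [hz]
  rw [Metric.tendsto_atTop]
  intro ε hε
  obtain ⟨w₀, hw₀⟩ : ∃ w₀, ‖w₀ - T w₀‖ ^ 2 < ‖u‖ ^ 2 + (ε / 2) ^ 2 := by
    have hopen : IsOpen {y : E | ‖y‖ ^ 2 < ‖u‖ ^ 2 + (ε / 2) ^ 2} :=
      isOpen_lt (by fun_prop) continuous_const
    obtain ⟨_, hy, w₀, rfl⟩ := mem_closure_iff.1 hu _ hopen
      (by simp only [Set.mem_ofPred_eq]; linarith [pow_pos (half_pos hε) 2])
    exact ⟨w₀, hy⟩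
  set w : ℕ → E := fun k => T^[k] w₀ with hw
  have hws (k : ℕ) : w (k + 1) = T (w k) := Function.iterate_succ_apply' T k w₀
  have hwnorm (k : ℕ) : ‖w k - T (w k)‖ ≤ ‖w₀ - T w₀‖ := by
    induction k with
    | zero => simp [hw]
    | succ k ih =>
      rw [hws]
      exact (hnonexp _ _).trans ih
  have hwu (k : ℕ) : ‖(w k - T (w k)) - u‖ < ε / 2 := by
    refine lt_of_pow_lt_pow_left₀ 2 (half_pos hε).le ?_
    have h1 := norm_sub_sq_le_of_norm_sq_le_inner (hmin (w k))
    have h2 : ‖w k - T (w k)‖ ^ 2 ≤ ‖w₀ - T w₀‖ ^ 2 := by gcongr; exact hwnorm k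
    linarith
  have hdiff : Tendsto (fun k => ‖(z k - T (z k)) - (w k - T (w k))‖ ^ 2) atTop (𝓝 0) := by
    set a : ℕ → ℝ := fun k => ‖z k - w k‖ ^ 2 with ha
    have hanti : Antitone a := antitone_nat_of_succ_le fun k => by
      simp only [ha, hz, hws]
      gcongr
      exact hnonexp _ _
    have hbdd : BddBelow (Set.range a) := ⟨0, by rintro _ ⟨k, rfl⟩; positivity⟩
    have hlim := tendsto_atTop_ciInf hanti hbdd
    have hdrop : Tendsto (fun k => a k - a (k + 1)) atTop (𝓝 0) := by
      simpa using hlim.sub (hlim.comp (tendsto_add_atTop_nat 1))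
    refine squeeze_zero (fun k => by positivity) (fun k => ?_) hdrop
    simp only [ha, hz, hws]
    exact hfirm _ _
  obtain ⟨k₀, hk₀⟩ := eventually_atTop.1 (hdiff.eventually_lt_const (pow_pos (half_pos hε) 2))
  refine ⟨k₀, fun k hk => ?_⟩
  have h1 := lt_of_pow_lt_pow_left₀ 2 (half_pos hε).le (hk₀ k hk)
  rw [dist_eq_norm]
  calc ‖(z k - T (z k)) - u‖
      = ‖((z k - T (z k)) - (w k - T (w k))) + ((w k - T (w k)) - u)‖ := by congr 1; abel
    _ ≤ _ := norm_add_le _ _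
    _ < ε := by linarith [hwu k]

/-- Tikhonov-regularised least squares over a closed convex set: a minimiser `p` of
`‖L p - c‖² + ε ‖p‖²` over `K`, with its first-order condition. -/
theorem exists_regularized_leastSquares [FiniteDimensional ℝ E] {K : Set E} (hne : K.Nonempty)
    (hcl : IsClosed K) (hcv : Convex ℝ K) (L : E →L[ℝ] E) (c : E) {ε : ℝ} (hε : 0 < ε) :
    ∃ p ∈ K, (∀ y ∈ K, ‖L p - c‖ ^ 2 + ε * ‖p‖ ^ 2 ≤ ‖L y - c‖ ^ 2 + ε * ‖y‖ ^ 2) ∧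
      ∀ y ∈ K, 0 ≤ ⟪L p - c, L (y - p)⟫ + ε * ⟪p, y - p⟫ := by
  obtain ⟨y₀, hy₀⟩ := hne
  have hcoer : Tendsto (fun y : E => ‖L y - c‖ ^ 2 + ε * ‖y‖ ^ 2) (cocompact E) atTop := by
    refine tendsto_atTop_mono (fun y => le_add_of_nonneg_left (sq_nonneg _)) ?_
    exact ((tendsto_pow_atTop two_ne_zero).comp
      (tendsto_norm_cocompact_atTop (E := E))).const_mul_atTop hε
  obtain ⟨p, hp, hmin⟩ := ContinuousOn.exists_isMinOn' (s := K)
    (f := fun y : E => ‖L y - c‖ ^ 2 + ε * ‖y‖ ^ 2) (by fun_prop) hcl hy₀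
    ((hcoer.eventually_ge_atTop _).filter_mono inf_le_left)
  refine ⟨p, hp, fun y hy => hmin hy, fun y hy => ?_⟩
  refine nonneg_of_forall_linear_add_quadratic
    (c := ‖L (y - p)‖ ^ 2 + ε * ‖y - p‖ ^ 2) fun s hs hs1 => ?_
  have h := hmin (hcv.add_smul_sub_mem hp hy ⟨hs.le, hs1⟩)
  simp only [Set.mem_ofPred_eq, map_add, map_smul] at h
  rw [add_sub_right_comm, norm_add_sq_real, norm_add_sq_real p, inner_smul_right, inner_smul_right,
    norm_smul, norm_smul, Real.norm_of_nonneg hs.le] at h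
  linarith

end InnerProduct

/-! ### Projections onto closed convex sets -/

section Projection

variable {n : ℕ} {C : Set (EuclideanSpace ℝ (Fin n))}

/-- The variational characterisation of nearest points of a convex set. -/
theorem isNearestPoint_iff_inner (hcv : Convex ℝ C) (x p : EuclideanSpace ℝ (Fin n)) :
    IsNearestPoint C x p ↔ p ∈ C ∧ ∀ y ∈ C, 0 ≤ ⟪p - x, y - p⟫ := by
  refine and_congr_right fun hp => ⟨fun h y hy => ?_, fun h y hy => ?_⟩
  · refine nonneg_of_forall_linear_add_quadratic (c := ‖y - p‖ ^ 2) fun s hs hs1 => ?_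
    have h1 := h _ (hcv.add_smul_sub_mem hp hy ⟨hs.le, hs1⟩)
    rw [add_sub_right_comm, norm_add_sq_real (p - x), inner_smul_right, norm_smul,
      Real.norm_of_nonneg hs.le] at h1
    linarith
  · have e : y - x = (p - x) + (y - p) := by abel
    rw [e, norm_add_sq_real]
    linarith [h y hy, sq_nonneg ‖y - p‖]

theorem isNearestPoint_proj (hne : C.Nonempty) (hcl : IsClosed C) (hcv : Convex ℝ C)
    (x : EuclideanSpace ℝ (Fin n)) : IsNearestPoint C x (proj C x) :=
  (isNearestPoint_iff_eq_proj hne hcl hcv x _).2 rfl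

theorem norm_sq_proj_zero_le_inner (hne : C.Nonempty) (hcl : IsClosed C) (hcv : Convex ℝ C)
    {y : EuclideanSpace ℝ (Fin n)} (hy : y ∈ C) : ‖proj C 0‖ ^ 2 ≤ ⟪proj C 0, y⟫ := by
  have h := ((isNearestPoint_iff_inner hcv _ _).1 (isNearestPoint_proj hne hcl hcv 0)).2 y hy
  rw [sub_zero, inner_sub_right, real_inner_self_eq_norm_sq] at h
  linarith

/-- Monotonicity of `I - P_C` along `P_C`. -/
theorem inner_proj_sub_nonneg (hne : C.Nonempty) (hcl : IsClosed C) (hcv : Convex ℝ C)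
    (x y : EuclideanSpace ℝ (Fin n)) :
    0 ≤ ⟪proj C x - proj C y, (x - proj C x) - (y - proj C y)⟫ := by
  have hx := (isNearestPoint_iff_inner hcv _ _).1 (isNearestPoint_proj hne hcl hcv x)
  have hy := (isNearestPoint_iff_inner hcv _ _).1 (isNearestPoint_proj hne hcl hcv y)
  have h1 := hx.2 _ hy.1
  have h2 := hy.2 _ hx.1
  rw [real_inner_comm]
  have e1 : ⟪proj C x - x, proj C y - proj C x⟫ = ⟪x - proj C x, proj C x - proj C y⟫ := by
    rw [← inner_neg_neg, neg_sub, neg_sub]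
  have e2 : ⟪proj C y - y, proj C x - proj C y⟫ = -⟪y - proj C y, proj C x - proj C y⟫ := by
    rw [← inner_neg_left, neg_sub]
  rw [inner_sub_left]
  linarith

theorem proj_submodule (N : Submodule ℝ (EuclideanSpace ℝ (Fin n)))
    (x : EuclideanSpace ℝ (Fin n)) : proj (N : Set (EuclideanSpace ℝ (Fin n))) x =
      N.starProjection x := by
  have hcl : IsClosed (N : Set (EuclideanSpace ℝ (Fin n))) := N.closed_of_finiteDimensional
  refine ((isNearestPoint_iff_eq_proj ⟨0, N.zero_mem⟩ hcl N.convex x _).1 ?_).symm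
  refine (isNearestPoint_iff_inner N.convex x _).2
    ⟨N.starProjection_apply_mem x, fun y hy => ?_⟩
  rw [← neg_sub, inner_neg_left, N.starProjection_inner_eq_zero x _
    (N.sub_mem hy (N.starProjection_apply_mem x)), neg_zero]

/-- If the least-norm point `u` of `closure C`, with `C` convex, lies in `closure S` for some
`S ⊆ C`, then `u` is the only least-norm point of `closure S`, even when `S` is not convex. -/
theorem isNearestPoint_closure_zero_iff_of_subset {S : Set (EuclideanSpace ℝ (Fin n))}
    (hne : C.Nonempty) (hcv : Convex ℝ C) (hSC : S ⊆ C) (hu : proj (closure C) 0 ∈ closure S)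
    (w : EuclideanSpace ℝ (Fin n)) :
    IsNearestPoint (closure S) 0 w ↔ w = proj (closure C) 0 := by
  have hmin := isNearestPoint_proj hne.closure isClosed_closure hcv.closure 0
  constructor
  · intro hw
    refine (isNearestPoint_iff_eq_proj hne.closure isClosed_closure hcv.closure 0 w).1
      ⟨closure_mono hSC hw.1, fun y hy => (hw.2 _ hu).trans (hmin.2 y hy)⟩
  · rintro rfl
    exact ⟨hu, fun y hy => hmin.2 y (closure_mono hSC hy)⟩

theorem setDist_nonneg (C₁ C₂ : Set (EuclideanSpace ℝ (Fin n))) : 0 ≤ setDist C₁ C₂ :=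
  Real.sInf_nonneg (by rintro _ ⟨x, -, y, -, rfl⟩; exact norm_nonneg _)

theorem setDist_eq_zero_iff {C₁ C₂ : Set (EuclideanSpace ℝ (Fin n))} (h₁ : C₁.Nonempty)
    (h₂ : C₂.Nonempty) : setDist C₁ C₂ = 0 ↔ 0 ∈ closure (C₁ - C₂) := by
  have hset : {r : ℝ | ∃ x ∈ C₁, ∃ y ∈ C₂, r = ‖x - y‖} = norm '' (C₁ - C₂) := by
    ext r
    simp only [Set.mem_ofPred_eq, Set.mem_image, Set.mem_sub]
    constructor
    · rintro ⟨x, hx, y, hy, rfl⟩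
      exact ⟨_, ⟨x, hx, y, hy, rfl⟩, rfl⟩
    · rintro ⟨_, ⟨x, hx, y, hy, rfl⟩, rfl⟩
      exact ⟨x, hx, y, hy, rfl⟩
  have hbdd : BddBelow (norm '' (C₁ - C₂)) := ⟨0, by rintro _ ⟨x, -, rfl⟩; exact norm_nonneg _⟩
  have hne : (norm '' (C₁ - C₂)).Nonempty := (h₁.sub h₂).image _
  rw [Metric.mem_closure_iff]
  constructor
  · intro h ε hε
    rw [setDist, hset] at h
    obtain ⟨_, ⟨d, hd, rfl⟩, hlt⟩ := exists_lt_of_csInf_lt hne (h.trans_lt hε)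
    exact ⟨d, hd, by simpa using hlt⟩
  · intro h
    refine le_antisymm (le_of_forall_pos_le_add fun ε hε => ?_) (setDist_nonneg _ _)
    obtain ⟨d, hd, hlt⟩ := h ε hε
    rw [setDist, hset, zero_add]
    exact (csInf_le hbdd ⟨d, hd, rfl⟩).trans (by simpa using hlt.le)

end Projection

/-! ### The operator `T₂` and its displacements -/

section Operator

variable {m n : ℕ} (A : Matrix (Fin m) (Fin n) ℝ) (b : Fin m → ℝ)
  (K : Set (EuclideanSpace ℝ (Fin n)))

/-- The null space of `A` as a submodule of Euclidean space. -/
def nullSubmodule : Submodule ℝ (EuclideanSpace ℝ (Fin n)) where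
  carrier := nullSpace A
  add_mem' := by
    intro x y hx hy
    simp only [nullSpace, Set.mem_ofPred_eq] at *
    rw [WithLp.ofLp_add, Matrix.mulVec_add, hx, hy, add_zero]
  zero_mem' := by simp [nullSpace]
  smul_mem' := by
    intro c x hx
    simp only [nullSpace, Set.mem_ofPred_eq] at *
    rw [WithLp.ofLp_smul, Matrix.mulVec_smul, hx, smul_zero]

variable {A}

theorem x₀_mem_affineSet (hA : A.rank = m) : x₀ A b ∈ affineSet A b := by
  have hunit : IsUnit (A * Aᵀ) := by
    rw [← Matrix.mulVec_surjective_iff_isUnit]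
    have hrank : (A * Aᵀ).rank = m := by rw [Matrix.rank_self_mul_transpose, hA]
    have htop : LinearMap.range (A * Aᵀ).mulVecLin = ⊤ :=
      Submodule.eq_top_of_finrank_eq (by rw [← Matrix.rank, hrank]; simp)
    exact LinearMap.range_eq_top.1 htop
  simp only [affineSet, x₀, Set.mem_ofPred_eq]
  rw [Matrix.mulVec_mulVec, Matrix.mulVec_mulVec,
    Matrix.mul_nonsing_inv _ ((Matrix.isUnit_iff_isUnit_det _).1 hunit), Matrix.one_mulVec]

variable (A) in
theorem starProjection_x₀ : (nullSubmodule A).starProjection (x₀ A b) = 0 := by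
  rw [Submodule.starProjection_apply_eq_zero_iff, Submodule.mem_orthogonal]
  intro y hy
  have hy' : A *ᵥ y.ofLp = 0 := hy
  rw [EuclideanSpace.inner_eq_star_dotProduct, x₀, star_trivial, dotProduct_comm,
    Matrix.dotProduct_mulVec, Matrix.vecMul_transpose, hy', zero_dotProduct]

theorem x₀_add_mem_affineSet (hA : A.rank = m) {y : EuclideanSpace ℝ (Fin n)}
    (hy : y ∈ nullSubmodule A) : x₀ A b + y ∈ affineSet A b := by
  have h1 : A *ᵥ (x₀ A b).ofLp = b := x₀_mem_affineSet b hA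
  have h2 : A *ᵥ y.ofLp = 0 := hy
  simp only [affineSet, Set.mem_ofPred_eq]
  rw [WithLp.ofLp_add, Matrix.mulVec_add, h1, h2, add_zero]

variable {b} in
theorem sub_x₀_mem_nullSubmodule (hA : A.rank = m) {a : EuclideanSpace ℝ (Fin n)}
    (ha : a ∈ affineSet A b) : a - x₀ A b ∈ nullSubmodule A := by
  have h1 : A *ᵥ (x₀ A b).ofLp = b := x₀_mem_affineSet b hA
  have h2 : A *ᵥ a.ofLp = b := ha
  change A *ᵥ (a - x₀ A b).ofLp = 0
  rw [WithLp.ofLp_sub, Matrix.mulVec_sub, h1, h2, sub_self]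

theorem convex_affineSet : Convex ℝ (affineSet A b) := by
  intro x hx y hy s t _ _ hst
  simp only [affineSet, Set.mem_ofPred_eq] at *
  rw [WithLp.ofLp_add, WithLp.ofLp_smul, WithLp.ofLp_smul, Matrix.mulVec_add, Matrix.mulVec_smul,
    Matrix.mulVec_smul, hx, hy, ← add_smul, hst, one_smul]

variable (A) in
theorem sub_T₂ (z : EuclideanSpace ℝ (Fin n)) :
    z - T₂ A b K z =
      proj K z - (x₀ A b + (nullSubmodule A).starProjection ((2 : ℝ) • proj K z - z)) := by
  have h : proj (nullSpace A) = (nullSubmodule A).starProjection :=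
    funext (proj_submodule (nullSubmodule A))
  simp only [T₂, Ttilde, refl, h]
  module

theorem ranDisplacement_subset (hA : A.rank = m) (hne : K.Nonempty) (hcl : IsClosed K)
    (hcv : Convex ℝ K) : ranDisplacement (T₂ A b K) ⊆ K - affineSet A b := by
  rintro _ ⟨z, rfl⟩
  simp only [sub_T₂]
  exact Set.sub_mem_sub (isNearestPoint_proj hne hcl hcv z).1
    (x₀_add_mem_affineSet b hA (Submodule.starProjection_apply_mem _ _))

variable {K}

variable (A) in
theorem firmlyNonexpansive_T₂ (hne : K.Nonempty) (hcl : IsClosed K) (hcv : Convex ℝ K)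
    (x y : EuclideanSpace ℝ (Fin n)) :
    ‖(x - T₂ A b K x) - (y - T₂ A b K y)‖ ^ 2 ≤
      ⟪(x - T₂ A b K x) - (y - T₂ A b K y), x - y⟫ := by
  -- With `e`, `f` the increments of `P_K` and `I - P_K`, the displacement changes by
  -- `(e - Q e) + Q f`, an orthogonal sum, while `x - y = e + f`.
  set Q := (nullSubmodule A).starProjection with hQ
  set e := proj K x - proj K y with he
  set f := (x - proj K x) - (y - proj K y) with hf
  have hef : 0 ≤ ⟪e, f⟫ := inner_proj_sub_nonneg hne hcl hcv x y
  have hxy : x - y = e + f := by rw [he, hf]; abel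
  have hd : (x - T₂ A b K x) - (y - T₂ A b K y) = (e - Q e) + Q f := by
    rw [sub_T₂, sub_T₂, he, hf]
    simp only [← hQ, map_sub, map_smul]
    module
  have hsymm (s t : EuclideanSpace ℝ (Fin n)) : ⟪Q s, t⟫ = ⟪s, Q t⟫ :=
    Submodule.inner_starProjection_left_eq_right _ s t
  have hidem (s : EuclideanSpace ℝ (Fin n)) : Q (Q s) = Q s :=
    Submodule.starProjection_eq_self_iff.2 (Submodule.starProjection_apply_mem _ _)
  rw [hd, hxy, ← real_inner_self_eq_norm_sq]
  simp only [inner_add_left, inner_add_right, inner_sub_left, inner_sub_right, hsymm, hidem]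
  linarith [hsymm f e, real_inner_comm (Q f) e]

/-- Near-optimal displacements, obtained from a minimiser over `K` of
`‖(I - Q) (p - x₀)‖² + ε ‖p‖²`. -/
theorem exists_displacement_norm_sq_le (hne : K.Nonempty) (hcl : IsClosed K) (hcv : Convex ℝ K)
    {ε : ℝ} (hε : 0 < ε) (hε1 : ε ≤ 1) :
    ∃ z, ∀ y ∈ K, ‖z - T₂ A b K z‖ ^ 2 ≤
      ‖y - (nullSubmodule A).starProjection y - x₀ A b‖ ^ 2 + ε * ‖y‖ ^ 2 := by
  set Q := (nullSubmodule A).starProjection with hQ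
  have hx₀ : Q (x₀ A b) = 0 := starProjection_x₀ A b
  have hsymm (s t : EuclideanSpace ℝ (Fin n)) : ⟪Q s, t⟫ = ⟪s, Q t⟫ :=
    Submodule.inner_starProjection_left_eq_right _ s t
  have hidem (s : EuclideanSpace ℝ (Fin n)) : Q (Q s) = Q s :=
    Submodule.starProjection_eq_self_iff.2 (Submodule.starProjection_apply_mem _ _)
  obtain ⟨p, hp, hmin, hfoc⟩ := exists_regularized_leastSquares hne hcl hcv
    (ContinuousLinearMap.id ℝ (EuclideanSpace ℝ (Fin n)) - Q) (x₀ A b) hε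
  simp only [sub_apply, ContinuousLinearMap.id_apply] at hmin hfoc
  set g := p - Q p - x₀ A b with hg
  have hQg : Q g = 0 := by simp only [hg, map_sub, hidem, hx₀, sub_self]
  refine ⟨p - (g + ε • p), fun y hy => le_trans ?_ (hmin y hy)⟩
  have hproj : proj K (p - (g + ε • p)) = p := by
    refine ((isNearestPoint_iff_eq_proj hne hcl hcv _ p).1
      ((isNearestPoint_iff_inner hcv _ p).2 ⟨hp, fun y hy => ?_⟩)).symm
    have h := hfoc y hy
    rw [inner_sub_right, ← hsymm, hQg, inner_zero_left, sub_zero] at h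
    rwa [sub_sub_cancel, inner_add_left, real_inner_smul_left]
  have hd : p - (g + ε • p) - T₂ A b K (p - (g + ε • p)) = g - ε • Q p := by
    rw [sub_T₂, hproj, ← hQ]
    simp only [map_sub, map_add, map_smul, hQg]
    rw [hg]
    module
  rw [hd, norm_sub_sq_real, inner_smul_right, ← hsymm, hQg, inner_zero_left, norm_smul,
    Real.norm_of_nonneg hε.le, mul_pow]
  have h1 : ‖Q p‖ ≤ ‖p‖ := Submodule.norm_starProjection_apply_le _ p
  have h2 : ε ^ 2 * ‖Q p‖ ^ 2 ≤ ε * ‖p‖ ^ 2 := by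
    gcongr
    nlinarith
  linarith

theorem convex_sub_affineSet (hcv : Convex ℝ K) : Convex ℝ (K - affineSet A b) :=
  hcv.sub (convex_affineSet b)

theorem proj_closure_mem_closure_ranDisplacement (hA : A.rank = m) (hne : K.Nonempty)
    (hcl : IsClosed K) (hcv : Convex ℝ K) :
    proj (closure (K - affineSet A b)) 0 ∈ closure (ranDisplacement (T₂ A b K)) := by
  have hDne : (K - affineSet A b).Nonempty := hne.sub ⟨_, x₀_mem_affineSet b hA⟩
  have hDcv := convex_sub_affineSet (A := A) b hcv
  set u := proj (closure (K - affineSet A b)) 0 with hu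
  have humem : u ∈ closure (K - affineSet A b) :=
    (isNearestPoint_proj hDne.closure isClosed_closure hDcv.closure 0).1
  rw [Metric.mem_closure_iff]
  intro η hη
  have hη2 : 0 < η ^ 2 / 2 := by positivity
  have hopen : IsOpen {d : EuclideanSpace ℝ (Fin n) | ‖d‖ ^ 2 < ‖u‖ ^ 2 + η ^ 2 / 2} :=
    isOpen_lt (by fun_prop) continuous_const
  obtain ⟨_, hd, y, hy, a, ha, rfl⟩ := mem_closure_iff.1 humem _ hopen
    (by simp only [Set.mem_ofPred_eq]; linarith)
  have hd' : ‖y - a‖ ^ 2 < ‖u‖ ^ 2 + η ^ 2 / 2 := hd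
  obtain ⟨ε, hε, hε1, hεy⟩ : ∃ ε : ℝ, 0 < ε ∧ ε ≤ 1 ∧ ε * ‖y‖ ^ 2 < η ^ 2 / 2 := by
    have hlim : Tendsto (fun ε : ℝ => ε * ‖y‖ ^ 2) (𝓝[>] 0) (𝓝 0) := by
      have : Continuous fun ε : ℝ => ε * ‖y‖ ^ 2 := by fun_prop
      simpa using (this.tendsto 0).mono_left nhdsWithin_le_nhds
    obtain ⟨ε, h1, h2⟩ :=
      ((hlim.eventually_lt_const hη2).and (Ioc_mem_nhdsGT (zero_lt_one' ℝ))).exists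
    exact ⟨ε, h2.1, h2.2, h1⟩
  obtain ⟨z, hz⟩ := exists_displacement_norm_sq_le (A := A) b hne hcl hcv hε hε1
  refine ⟨_, ⟨z, rfl⟩, ?_⟩
  rw [dist_comm, dist_eq_norm]
  refine lt_of_pow_lt_pow_left₀ 2 hη.le ?_
  have h1 := norm_sub_sq_le_of_norm_sq_le_inner (norm_sq_proj_zero_le_inner hDne.closure
    isClosed_closure hDcv.closure
    (subset_closure (ranDisplacement_subset b K hA hne hcl hcv ⟨z, rfl⟩)))
  -- `y - Q y - x₀` is the image of `y - a` under the contraction `I - Q`.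
  have h2 : ‖y - (nullSubmodule A).starProjection y - x₀ A b‖ ≤ ‖y - a‖ := by
    have ha' := Submodule.starProjection_eq_self_iff.2 (sub_x₀_mem_nullSubmodule hA ha)
    rw [map_sub, starProjection_x₀, sub_zero] at ha'
    have e : y - (nullSubmodule A).starProjection y - x₀ A b =
        (nullSubmodule A)ᗮ.starProjection (y - a) := by
      rw [Submodule.starProjection_orthogonal']
      simp only [sub_apply, one_apply_eq_self, map_sub, ha']
      abel
    rw [e]
    exact Submodule.norm_starProjection_apply_le _ _
  have h3 : ‖y - (nullSubmodule A).starProjection y - x₀ A b‖ ^ 2 ≤ ‖y - a‖ ^ 2 := by gcongr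
  have h4 := hz y hy
  simp only [← hu] at h1
  linarith

end Operator

/-! ### Certificates of infeasibility -/

theorem setDist_affineSet_eq_zero_iff {m n : ℕ} {A : Matrix (Fin m) (Fin n) ℝ} (hA : A.rank = m)
    (b : Fin m → ℝ) {K : Set (EuclideanSpace ℝ (Fin n))} (hne : K.Nonempty) (hcv : Convex ℝ K) :
    setDist K (affineSet A b) = 0 ↔ proj (closure (K - affineSet A b)) 0 = 0 := by
  have hane : (affineSet A b).Nonempty := ⟨_, x₀_mem_affineSet b hA⟩
  have hmin := isNearestPoint_proj (hne.sub hane).closure isClosed_closure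
    (convex_sub_affineSet b hcv).closure 0
  rw [setDist_eq_zero_iff hne hane]
  refine ⟨fun h => ?_, fun h => h ▸ hmin.1⟩
  simpa using hmin.2 0 h

theorem Feasible.setDist_eq_zero {m n : ℕ} {A : Matrix (Fin m) (Fin n) ℝ} {b : Fin m → ℝ}
    {K : Set (EuclideanSpace ℝ (Fin n))} (h : Feasible A b K) :
    setDist K (affineSet A b) = 0 := by
  obtain ⟨x, hxK, hxA⟩ := h
  exact (setDist_eq_zero_iff ⟨x, hxK⟩ ⟨x, hxA⟩).2
    (subset_closure ⟨x, hxK, x, hxA, sub_self x⟩)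

theorem stronglyInfeasible_iff {m n : ℕ} {A : Matrix (Fin m) (Fin n) ℝ} {b : Fin m → ℝ}
    {K : Set (EuclideanSpace ℝ (Fin n))} :
    StronglyInfeasible A b K ↔ setDist K (affineSet A b) ≠ 0 :=
  ⟨fun h => h.2.ne', fun h =>
    ⟨fun hf => h hf.setDist_eq_zero, lt_of_le_of_ne (setDist_nonneg _ _) h.symm⟩⟩

theorem weaklyInfeasible_or_feasible_iff {m n : ℕ} {A : Matrix (Fin m) (Fin n) ℝ}
    {b : Fin m → ℝ} {K : Set (EuclideanSpace ℝ (Fin n))} :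
    WeaklyInfeasible A b K ∨ Feasible A b K ↔ setDist K (affineSet A b) = 0 := by
  refine ⟨fun h => h.elim And.right Feasible.setDist_eq_zero, fun h => ?_⟩
  by_cases hf : Feasible A b K
  · exact Or.inr hf
  · exact Or.inl ⟨hf, h⟩

end ConicDRS

theorem mainTheorem2 {m n : ℕ} (A : Matrix (Fin m) (Fin n) ℝ) (hA : A.rank = m)
    (b : Fin m → ℝ) (K : Set (EuclideanSpace ℝ (Fin n)))
    (hKne : K.Nonempty) (hKcl : IsClosed K) (hKcv : Convex ℝ K) (hKcone : ConicDRS.IsCone K)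
    (v : EuclideanSpace ℝ (Fin n))
    (hv : v = ConicDRS.infimalDisplacement (ConicDRS.T₂ A b K)) :
    (∀ w, ConicDRS.IsNearestPoint
        (closure (ConicDRS.ranDisplacement (ConicDRS.T₂ A b K))) 0 w ↔ w = v) ∧
    v = ConicDRS.proj (closure (K - ConicDRS.affineSet A b)) 0 ∧
    (∀ z : ℕ → EuclideanSpace ℝ (Fin n),
      (∀ k, z (k + 1) = ConicDRS.T₂ A b K (z k)) →
        Tendsto (fun k => z k - z (k + 1)) atTop (𝓝 v)) ∧
    (ConicDRS.StronglyInfeasible A b K ↔ v ≠ 0) ∧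
    (ConicDRS.WeaklyInfeasible A b K ∨ ConicDRS.Feasible A b K ↔ v = 0) := by
  have hane : (ConicDRS.affineSet A b).Nonempty := ⟨_, ConicDRS.x₀_mem_affineSet b hA⟩
  have hDne : (K - ConicDRS.affineSet A b).Nonempty := hKne.sub hane
  have hDcv := ConicDRS.convex_sub_affineSet (A := A) b hKcv
  have hsub := ConicDRS.ranDisplacement_subset b K hA hKne hKcl hKcv
  have hmem := ConicDRS.proj_closure_mem_closure_ranDisplacement b hA hKne hKcl hKcv
  have hnear := ConicDRS.isNearestPoint_closure_zero_iff_of_subset hDne hDcv hsub hmem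
  have hvu : v = ConicDRS.proj (closure (K - ConicDRS.affineSet A b)) 0 := by
    have hex : ∃ p, ConicDRS.IsNearestPoint
        (closure (ConicDRS.ranDisplacement (ConicDRS.T₂ A b K))) 0 p := ⟨_, (hnear _).2 rfl⟩
    rw [hv, ConicDRS.infimalDisplacement, ConicDRS.proj, dif_pos hex]
    exact (hnear _).1 hex.choose_spec
  rw [← hvu] at hmem hnear
  have hdist := ConicDRS.setDist_affineSet_eq_zero_iff hA b hKne hKcv
  rw [← hvu] at hdist
  refine ⟨hnear, hvu, fun z hz => ?_, ?_, ?_⟩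
  · refine ConicDRS.tendsto_displacement_of_firmlyNonexpansive
      (ConicDRS.firmlyNonexpansive_T₂ A b hKne hKcl hKcv) hmem (fun x => ?_) hz
    rw [hvu]
    exact ConicDRS.norm_sq_proj_zero_le_inner hDne.closure isClosed_closure hDcv.closure
      (subset_closure (hsub ⟨x, rfl⟩))
  · rw [ConicDRS.stronglyInfeasible_iff, ne_eq, hdist]
  · rw [ConicDRS.weaklyInfeasible_or_feasible_iff, hdist]
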